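/- Let $K$ be a compact Hausdorff space, let $C(K)$ be the space of continuous functions $K\to\mathbb{R}$, and let $\overline{C(K)} := C(K)/\mathbb{R}\mathbf{1}$ be its quotient by the constant functions, with the class of $f$ denoted by $\overline{f}$, equipped with the variation norm $\|\overline{f}\|_{\mathrm{var}} = \sup_{x\in K} f(x) - \inf_{x\in K} f(x)$ (understood as $0$ if $K=\emptyset$). Let $C_2=\{1,-1\}$ be the cyclic group of order $2$, let $\mathrm{Homeo}(K)$ be the group of homeomorphisms of $K$ onto itself, and let $C_2\times\mathrm{Homeo}(K)$ act on the additive group $\overline{C(K)}$ by $(\varepsilon,\theta)\cdot\overline{f} = \varepsilon\,\overline{f\circ\theta^{-1}}$. Then the group of all surjective (not necessarily linear) isometries of $(\overline{C(K)},\|\cdot\|_{\mathrm{var}})$ onto itself is isomorphic, as a group, to the semidirect product $\overline{C(K)}\rtimes(C_2\times\mathrm{Homeo}(K))$ formed with this action if and only if $K$ has at least three points. -/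

import Mathlib

namespace VariationQuotient

/-- The line `ℝ𝟏` of constant functions in `C(K)`. -/
abbrev constants (K : Type*) [TopologicalSpace K] : Submodule ℝ C(K, ℝ) :=
  Submodule.span ℝ {(1 : C(K, ℝ))}

/-- The real vector space `C(K) / ℝ𝟏`. It is a separate type, so that it does not carry the
quotient norm of the supremum norm; its norm is the variation norm defined below. -/
def QuotConst (K : Type*) [TopologicalSpace K] : Type _ :=
  C(K, ℝ) ⧸ constants K

section Algebra

variable {K : Type*} [TopologicalSpace K]

instance : AddCommGroup (QuotConst K) :=
  inferInstanceAs (AddCommGroup (C(K, ℝ) ⧸ constants K))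

instance : Module ℝ (QuotConst K) :=
  inferInstanceAs (Module ℝ (C(K, ℝ) ⧸ constants K))

/-- The quotient map `f ↦ f̄`. -/
def mk : C(K, ℝ) →ₗ[ℝ] QuotConst K := (constants K).mkQ

theorem mk_surjective : Function.Surjective (mk : C(K, ℝ) →ₗ[ℝ] QuotConst K) :=
  Submodule.mkQ_surjective _

theorem mk_eq_mk_iff (f g : C(K, ℝ)) :
    (mk f : QuotConst K) = mk g ↔ ∃ c : ℝ, ∀ x, f x = g x + c := by
  have h : (mk f : QuotConst K) = mk g ↔ f - g ∈ constants K :=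
    Submodule.Quotient.eq (constants K)
  rw [h, Submodule.mem_span_singleton]
  refine exists_congr fun c => ?_
  rw [ContinuousMap.ext_iff]
  refine forall_congr' fun x => ?_
  simp only [ContinuousMap.smul_apply, ContinuousMap.one_apply, ContinuousMap.sub_apply,
    smul_eq_mul, mul_one]
  constructor <;> intro h <;> linarith

/-- Composition with a continuous map `θ` descends to `C(K) / ℝ𝟏`: `f̄ ↦ (f ∘ θ)‾`. -/
def comp (θ : C(K, K)) : QuotConst K →ₗ[ℝ] QuotConst K :=
  (constants K).mapQ (constants K) (ContinuousMap.compRightAlgHom ℝ ℝ θ).toLinearMap (by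
    rw [Submodule.span_le, Set.singleton_subset_iff]
    exact Submodule.mem_span_singleton_self _)

theorem comp_mk (θ : C(K, K)) (f : C(K, ℝ)) : comp θ (mk f) = mk (f.comp θ) := rfl

/-- The pair `(ε, θ)` acts on `C(K) / ℝ𝟏` by `f̄ ↦ ε • (f ∘ θ⁻¹)‾`. -/
def act (p : ℤˣ × (K ≃ₜ K)) (v : QuotConst K) : QuotConst K :=
  (p.1 : ℤ) • comp (p.2.symm : C(K, K)) v

theorem act_mk (p : ℤˣ × (K ≃ₜ K)) (f : C(K, ℝ)) :
    act p (mk f) = (p.1 : ℤ) • mk (f.comp (p.2.symm : C(K, K))) := rfl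

theorem act_add (p : ℤˣ × (K ≃ₜ K)) (v w : QuotConst K) :
    act p (v + w) = act p v + act p w := by
  simp [act]

theorem act_one (v : QuotConst K) : act 1 v = v := by
  obtain ⟨f, rfl⟩ := mk_surjective v
  rw [act_mk]
  simp only [Prod.fst_one, Units.val_one, one_smul]
  rfl

theorem act_mul (p q : ℤˣ × (K ≃ₜ K)) (v : QuotConst K) :
    act (p * q) v = act p (act q v) := by
  obtain ⟨f, rfl⟩ := mk_surjective v
  rw [act_mk, act_mk, act, map_zsmul, comp_mk, smul_smul]
  rfl

/-- The action of `C₂ × Homeo(K)` on the additive group `C(K) / ℝ𝟏`, where `C₂ = ℤˣ = {1, -1}`,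
given by `(ε, θ) • f̄ = ε • (f ∘ θ⁻¹)‾`. -/
def action (K : Type*) [TopologicalSpace K] :
    ℤˣ × (K ≃ₜ K) →* MulAut (Multiplicative (QuotConst K)) where
  toFun p :=
    { toFun := fun v => Multiplicative.ofAdd (act p v.toAdd)
      invFun := fun v => Multiplicative.ofAdd (act p⁻¹ v.toAdd)
      left_inv := fun v => by
        simp [← act_mul, act_one]
      right_inv := fun v => by
        simp [← act_mul, act_one]
      map_mul' := fun v w => by
        simp [act_add] }
  map_one' := by
    ext v
    simp [act_one]
  map_mul' p q := by
    ext v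
    simp [act_mul]

/-- The variation seminorm `sup f - inf f` on `C(K)`. -/
noncomputable def variation (f : C(K, ℝ)) : ℝ := (⨆ x, f x) - ⨅ x, f x

theorem variation_of_isEmpty [IsEmpty K] (f : C(K, ℝ)) : variation f = 0 := by
  simp [variation]

theorem variation_le [Nonempty K] {f : C(K, ℝ)} {c : ℝ} (h : ∀ x y, f x - f y ≤ c) :
    variation f ≤ c := by
  have h1 : (⨆ x, f x) ≤ (⨅ y, f y) + c := by
    refine ciSup_le fun x => ?_
    have : f x - c ≤ ⨅ y, f y := le_ciInf fun y => by linarith [h x y]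
    linarith
  unfold variation
  linarith

end Algebra

section Norm

variable {K : Type*} [TopologicalSpace K] [CompactSpace K]

theorem bddAbove_range (f : C(K, ℝ)) : BddAbove (Set.range f) :=
  (isCompact_range f.continuous).bddAbove

theorem bddBelow_range (f : C(K, ℝ)) : BddBelow (Set.range f) :=
  (isCompact_range f.continuous).bddBelow

theorem sub_le_variation (f : C(K, ℝ)) (x y : K) : f x - f y ≤ variation f :=
  sub_le_sub (le_ciSup (bddAbove_range f) x) (ciInf_le (bddBelow_range f) y)

theorem variation_congr {f g : C(K, ℝ)} (h : ∀ x y, f x - f y = g x - g y) :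
    variation f = variation g := by
  rcases isEmpty_or_nonempty K with _ | _
  · simp [variation_of_isEmpty]
  · exact le_antisymm (variation_le fun x y => h x y ▸ sub_le_variation g x y)
      (variation_le fun x y => h x y ▸ sub_le_variation f x y)

/-- The variation norm `‖f̄‖ = sup f - inf f` on `C(K) / ℝ𝟏`. -/
noncomputable def varNorm : QuotConst K → ℝ :=
  Quotient.lift variation fun f g h => by
    obtain ⟨c, hc⟩ := (mk_eq_mk_iff f g).1 (Quotient.sound h)
    exact variation_congr fun x y => by rw [hc x, hc y]; ring

theorem varNorm_mk (f : C(K, ℝ)) : varNorm (mk f) = (⨆ x, f x) - ⨅ x, f x := rfl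

/-- `C(K) / ℝ𝟏` normed by the variation norm. -/
noncomputable instance : NormedAddCommGroup (QuotConst K) :=
  AddGroupNorm.toNormedAddCommGroup
    { toFun := varNorm
      map_zero' := by
        change variation (0 : C(K, ℝ)) = 0
        rcases isEmpty_or_nonempty K with _ | _
        · exact variation_of_isEmpty _
        · simp [variation]
      add_le' := fun v w => by
        obtain ⟨f, rfl⟩ := mk_surjective v
        obtain ⟨g, rfl⟩ := mk_surjective w
        rw [← map_add]
        change variation (f + g) ≤ variation f + variation g
        rcases isEmpty_or_nonempty K with _ | _
        · simp [variation_of_isEmpty]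
        · refine variation_le fun x y => ?_
          have h1 := sub_le_variation f x y
          have h2 := sub_le_variation g x y
          simp only [ContinuousMap.add_apply]
          linarith
      neg' := fun v => by
        obtain ⟨f, rfl⟩ := mk_surjective v
        rw [← map_neg]
        change variation (-f) = variation f
        rcases isEmpty_or_nonempty K with _ | _
        · simp [variation_of_isEmpty]
        · refine le_antisymm (variation_le fun x y => ?_) (variation_le fun x y => ?_)
          · have := sub_le_variation f y x
            simp only [ContinuousMap.neg_apply]
            linarith
          · have := sub_le_variation (-f) y x
            simp only [ContinuousMap.neg_apply] at this
            linarith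
      eq_zero_of_map_eq_zero' := fun v h => by
        obtain ⟨f, rfl⟩ := mk_surjective v
        change variation f = 0 at h
        rw [← map_zero (mk : C(K, ℝ) →ₗ[ℝ] QuotConst K), mk_eq_mk_iff]
        rcases isEmpty_or_nonempty K with _ | ⟨⟨y⟩⟩
        · exact ⟨0, fun x => isEmptyElim x⟩
        · refine ⟨f y, fun x => ?_⟩
          have h1 := sub_le_variation f x y
          have h2 := sub_le_variation f y x
          simp only [ContinuousMap.zero_apply]
          linarith }

theorem norm_mk (f : C(K, ℝ)) : ‖(mk f : QuotConst K)‖ = (⨆ x, f x) - ⨅ x, f x := rfl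

theorem dist_mk (f g : C(K, ℝ)) :
    dist (mk f : QuotConst K) (mk g) = (⨆ x, (f x - g x)) - ⨅ x, (f x - g x) := by
  rw [dist_eq_norm, ← map_sub]
  rfl

noncomputable instance : NormedSpace ℝ (QuotConst K) where
  norm_smul_le c v := by
    obtain ⟨f, rfl⟩ := mk_surjective v
    rw [← map_smul, Real.norm_eq_abs]
    change variation (c • f) ≤ |c| * variation f
    rcases isEmpty_or_nonempty K with _ | _
    · simp [variation_of_isEmpty]
    · refine variation_le fun x y => ?_
      have h : |f x - f y| ≤ variation f :=
        abs_le.2 ⟨by linarith [sub_le_variation f y x], sub_le_variation f x y⟩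
      calc (c • f) x - (c • f) y = c * (f x - f y) := by
            simp only [ContinuousMap.smul_apply, smul_eq_mul]; ring
        _ ≤ |c * (f x - f y)| := le_abs_self _
        _ = |c| * |f x - f y| := abs_mul _ _
        _ ≤ |c| * variation f := by gcongr

end Norm

end VariationQuotient

/-! By Mazur–Ulam every surjective isometry is a translation after a linear isometry `T`. The
functionals `diff x y` norm the space, and `T` permutes them (`exists_diff_comp_eq`): vectors
attaining their norm at a given pair form a cone, compactness sends the cone to vectors attaining at
one common pair, and the cone spans. The relation `diff x y + diff y z = diff x z` on three points
then forces `T` to preserve or reverse orientation coherently, giving a sign and a homeomorphism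
(`exists_eq_act`). With at most two points the groups are told apart by their centres: the isometry
group always has trivial centre, while the semidirect product has a central element of sign `-1`. -/

namespace VariationQuotient

/-! ### Differences of point evaluations -/

section Functionals

variable {K : Type*} [TopologicalSpace K]

/-- The linear functional `f̄ ↦ f x - f y`. -/
def diff (x y : K) : QuotConst K →ₗ[ℝ] ℝ :=
  (constants K).liftQ
    { toFun := fun f => f x - f y
      map_add' := fun f g => by simp only [ContinuousMap.add_apply]; ring
      map_smul' := fun c f => by
        simp only [ContinuousMap.smul_apply, smul_eq_mul, RingHom.id_apply]; ring }
    (by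
      rw [Submodule.span_le, Set.singleton_subset_iff]
      simp)

theorem diff_mk (x y : K) (f : C(K, ℝ)) : diff x y (mk f) = f x - f y := rfl

theorem diff_self (x : K) (v : QuotConst K) : diff x x v = 0 := by
  obtain ⟨f, rfl⟩ := mk_surjective v
  simp [diff_mk]

theorem diff_swap (x y : K) (v : QuotConst K) : diff y x v = -diff x y v := by
  obtain ⟨f, rfl⟩ := mk_surjective v
  simp [diff_mk]

theorem diff_sub_diff (a x y : K) (v : QuotConst K) : diff a y v - diff a x v = diff x y v := by
  obtain ⟨f, rfl⟩ := mk_surjective v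
  simp [diff_mk]

theorem ext_diff {v w : QuotConst K} (h : ∀ x y, diff x y v = diff x y w) : v = w := by
  obtain ⟨f, rfl⟩ := mk_surjective v
  obtain ⟨g, rfl⟩ := mk_surjective w
  rw [mk_eq_mk_iff]
  rcases isEmpty_or_nonempty K with _ | ⟨⟨y⟩⟩
  · exact ⟨0, fun x => isEmptyElim x⟩
  · refine ⟨f y - g y, fun x => ?_⟩
    have := h x y
    simp only [diff_mk] at this
    linarith

theorem diff_act (p : ℤˣ × (K ≃ₜ K)) (x y : K) (v : QuotConst K) :
    diff x y (act p v) = ((p.1 : ℤ) : ℝ) * diff (p.2.symm x) (p.2.symm y) v := by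
  obtain ⟨f, rfl⟩ := mk_surjective v
  rw [act_mk, map_zsmul, diff_mk, diff_mk, zsmul_eq_mul]
  rfl

theorem diff_continuous (v : QuotConst K) : Continuous fun p : K × K => diff p.1 p.2 v := by
  obtain ⟨f, rfl⟩ := mk_surjective v
  simp only [diff_mk]
  fun_prop

end Functionals

/-! ### Norm attainment -/

section Compact

variable {K : Type*} [TopologicalSpace K] [CompactSpace K]

theorem diff_le_norm (x y : K) (v : QuotConst K) : diff x y v ≤ ‖v‖ := by
  obtain ⟨f, rfl⟩ := mk_surjective v
  exact sub_le_variation f x y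

theorem norm_le_of_diff_le [Nonempty K] {v : QuotConst K} {c : ℝ} (h : ∀ x y, diff x y v ≤ c) :
    ‖v‖ ≤ c := by
  obtain ⟨f, rfl⟩ := mk_surjective v
  exact variation_le h

theorem exists_diff_eq_norm [Nonempty K] (v : QuotConst K) : ∃ p : K × K, diff p.1 p.2 v = ‖v‖ := by
  obtain ⟨p, -, hp⟩ := isCompact_univ.exists_isMaxOn Set.univ_nonempty (diff_continuous v).continuousOn
  exact ⟨p, le_antisymm (diff_le_norm _ _ _)
    (norm_le_of_diff_le fun x y => hp (Set.mem_univ (x, y)))⟩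

theorem norm_add_eq_of_diff_eq_norm {x y : K} {v w : QuotConst K} (hv : diff x y v = ‖v‖)
    (hw : diff x y w = ‖w‖) : ‖v + w‖ = ‖v‖ + ‖w‖ := by
  refine le_antisymm (norm_add_le _ _) ?_
  rw [← hv, ← hw, ← map_add]
  exact diff_le_norm _ _ _

/-- All vectors whose norm is attained at `(x, y)` have images under a linear isometry whose norms
are attained at a common pair. -/
theorem exists_common_diff_eq_norm (T : QuotConst K ≃ₗᵢ[ℝ] QuotConst K) (x y : K) :
    ∃ p q : K, ∀ v, diff x y v = ‖v‖ → diff p q (T v) = ‖v‖ := by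
  have : Nonempty K := ⟨x⟩
  let t : {v : QuotConst K // diff x y v = ‖v‖} → Set (K × K) :=
    fun v => {p | diff p.1 p.2 (T v) = ‖T v‖}
  have hcl : ∀ v, IsClosed (t v) := fun v => isClosed_eq (diff_continuous _) continuous_const
  -- Norms add on the cone, so a pair attaining the norm of `T (v + w)` attains those of `T v` and
  -- `T w`.
  have hdir : Directed (· ⊇ ·) t := by
    intro v w
    have hadd := norm_add_eq_of_diff_eq_norm v.2 w.2
    refine ⟨⟨v + w, by rw [hadd, map_add, v.2, w.2]⟩, ?_, ?_⟩ <;>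
    · intro p hp
      have hp' : diff p.1 p.2 (T (v + w)) = ‖T (v + w)‖ := hp
      rw [T.norm_map, hadd, map_add, map_add] at hp'
      have h1 := diff_le_norm p.1 p.2 (T v)
      have h2 := diff_le_norm p.1 p.2 (T w)
      simp only [t, Set.mem_ofPred_eq]
      rw [T.norm_map] at h1 h2 ⊢
      linarith
  have : Nonempty {v : QuotConst K // diff x y v = ‖v‖} := ⟨⟨0, by simp⟩⟩
  obtain ⟨p, hp⟩ := IsCompact.nonempty_iInter_of_directed_nonempty_isCompact_isClosed t hdir
    (fun v => exists_diff_eq_norm _) (fun v => (hcl v).isCompact) hcl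
  refine ⟨p.1, p.2, fun v hv => ?_⟩
  have h : diff p.1 p.2 (T v) = ‖T v‖ := Set.mem_iInter.1 hp ⟨v, hv⟩
  rwa [T.norm_map] at h

end Compact

/-! ### Separation of points and rigidity of linear isometries -/

section Separation

variable {K : Type*} [TopologicalSpace K] [CompactSpace K] [T2Space K]

open Classical in
theorem exists_eq_ite_of_finite (p : K) {s : Set K} (hs : s.Finite) :
    ∃ f : C(K, ℝ), ∀ q ∈ s, f q = if q = p then 1 else 0 := by
  obtain ⟨f, h0, h1, -⟩ := exists_continuous_zero_one_of_isClosed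
    (s := s \ {p}) (t := {p}) (hs.subset Set.sdiff_subset).isClosed isClosed_singleton
    Set.disjoint_sdiff_left
  refine ⟨f, fun q hq => ?_⟩
  split_ifs with h
  · exact h1 h
  · exact h0 ⟨hq, h⟩

theorem exists_diff_eq_one {x y : K} (h : x ≠ y) : ∃ v : QuotConst K, diff x y v = 1 := by
  obtain ⟨f, hf⟩ := exists_eq_ite_of_finite x (Set.toFinite {x, y})
  exact ⟨mk f, by rw [diff_mk, hf x (by simp), hf y (by simp)]; simp [h.symm]⟩

theorem eq_of_diff_eq {a b c d : K} (hab : a ≠ b) (h : ∀ v, diff a b v = diff c d v) :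
    a = c ∧ b = d := by
  classical
  have key : ∀ p : K, ((if a = p then 1 else 0) - (if b = p then 1 else 0) : ℝ) =
      (if c = p then 1 else 0) - (if d = p then 1 else 0) := fun p => by
    obtain ⟨f, hf⟩ := exists_eq_ite_of_finite p (Set.toFinite {a, b, c, d})
    have := h (mk f)
    rwa [diff_mk, diff_mk, hf a (by simp), hf b (by simp), hf c (by simp), hf d (by simp)] at this
  have ha := key a
  have hb := key b
  rw [if_pos rfl, if_neg hab.symm] at ha
  rw [if_pos rfl, if_neg hab] at hb
  constructor
  · by_contra hc
    rw [if_neg (Ne.symm hc)] at ha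
    split_ifs at ha <;> norm_num at ha
  · by_contra hd
    rw [if_neg (Ne.symm hd)] at hb
    split_ifs at hb <;> norm_num at hb

/-- Evaluations at distinct points are independent, so of the four point masses on the left a
positive and a negative one must cancel: either `b = c` or `a = d`. -/
theorem eq_or_eq_of_diff_add_diff {a b c d e f : K} (hab : a ≠ b) (hcd : c ≠ d)
    (hef : e ≠ f) (h : ∀ v, diff a b v + diff c d v = diff e f v) :
    (b = c ∧ a = e ∧ d = f) ∨ (a = d ∧ c = e ∧ b = f) := by
  classical
  have key : ∀ p : K, ((if a = p then 1 else 0) - (if b = p then 1 else 0) +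
      ((if c = p then 1 else 0) - (if d = p then 1 else 0)) : ℝ) =
      (if e = p then 1 else 0) - (if f = p then 1 else 0) := fun p => by
    obtain ⟨g, hg⟩ := exists_eq_ite_of_finite p (Set.toFinite {a, b, c, d, e, f})
    have := h (mk g)
    rwa [diff_mk, diff_mk, diff_mk, hg a (by simp), hg b (by simp), hg c (by simp), hg d (by simp),
      hg e (by simp), hg f (by simp)] at this
  have ha := key a
  have hb := key b
  have hc := key c
  have hd := key d
  have he := key e
  clear key h
  grind

/-- The vectors whose norm is attained at `(x, y)` span. -/
theorem linearMap_ext_of_diff_eq_norm {x y : K} (hxy : x ≠ y) {φ ψ : QuotConst K →ₗ[ℝ] ℝ}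
    (h : ∀ v, diff x y v = ‖v‖ → φ v = ψ v) : φ = ψ := by
  have : Nonempty K := ⟨x⟩
  obtain ⟨u, hux, huy, hu⟩ := exists_continuous_zero_one_of_isClosed
    (isClosed_singleton (x := y)) (isClosed_singleton (x := x)) (by simpa using hxy.symm)
  replace hux : u y = 0 := hux rfl
  replace huy : u x = 1 := huy rfl
  have hmem : ∀ g : C(K, ℝ), (∀ z, g y ≤ g z ∧ g z ≤ g x) → φ (mk g) = ψ (mk g) := fun g hg =>
    h _ (le_antisymm (diff_le_norm _ _ _) (norm_le_of_diff_le fun p q => by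
      rw [diff_mk, diff_mk]
      linarith [(hg p).2, (hg q).1]))
  have hzero : ∀ f : C(K, ℝ), f x = 0 → f y = 0 → φ (mk f) = ψ (mk f) := by
    intro f hx hy
    let M : ℝ := ‖f‖
    have hM : ∀ z, |f z| ≤ M := fun z => f.norm_coe_le_norm z
    have hM0 : 0 ≤ M := norm_nonneg f
    -- `M * (2 * u - 1)` runs from `-M` at `y` to `M` at `x`; clamping it between `-M + f⁻` and `M -
    -- f⁺` keeps both `g` and `g + f` in `[-M, M]`. So `f` is a difference of two cone elements.
    let g : C(K, ℝ) :=
      { toFun := fun z => max (-M + max (-f z) 0) (min (M - max (f z) 0) (M * (2 * u z - 1)))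
        continuous_toFun := by fun_prop }
    have hg : ∀ z, g z = max (-M + max (-f z) 0) (min (M - max (f z) 0) (M * (2 * u z - 1))) :=
      fun _ => rfl
    have hgx : g x = M := by
      rw [hg, hx, huy]; norm_num [hM0]
    have hgy : g y = -M := by
      rw [hg, hy, hux]; norm_num
    have hlow : ∀ z, -M + max (-f z) 0 ≤ g z := fun z => le_max_left _ _
    have hupp : ∀ z, g z ≤ M - max (f z) 0 := fun z => by
      refine max_le ?_ (min_le_left _ _)
      have := abs_le.1 (hM z)
      rcases le_total (f z) 0 with h | h
      · rw [max_eq_right h, max_eq_left (by linarith)]; linarith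
      · rw [max_eq_left h, max_eq_right (by linarith)]; linarith
    have h1 := hmem g fun z => by
      rw [hgx, hgy]
      constructor
      · linarith [hlow z, le_max_right (-f z) 0]
      · linarith [hupp z, le_max_right (f z) 0]
    have h2 := hmem (g + f) fun z => by
      simp only [ContinuousMap.add_apply]
      rw [hgx, hgy, hx, hy]
      constructor
      · linarith [hlow z, le_max_left (-f z) 0]
      · linarith [hupp z, le_max_left (f z) 0]
    rw [map_add, map_add, map_add] at h2
    linarith
  have hu' := hmem u fun z => by rw [hux, huy]; exact hu z
  refine LinearMap.ext fun v => ?_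
  obtain ⟨f, rfl⟩ := mk_surjective v
  -- Removing a constant and a multiple of `u`, itself in the cone, makes `f` vanish at both points.
  have h1 := hzero (f - f y • 1 - (f x - f y) • u) (by simp [huy]) (by simp [hux])
  have hone : (mk (1 : C(K, ℝ)) : QuotConst K) = 0 := by
    rw [← map_zero (mk : C(K, ℝ) →ₗ[ℝ] QuotConst K), mk_eq_mk_iff]
    exact ⟨1, fun z => by simp⟩
  simp only [map_sub, map_smul, hone, smul_zero, sub_zero, hu'] at h1
  linarith

theorem exists_diff_comp_eq (T : QuotConst K ≃ₗᵢ[ℝ] QuotConst K) {x y : K} (hxy : x ≠ y) :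
    ∃ p q : K, p ≠ q ∧ ∀ v, diff p q (T v) = diff x y v := by
  obtain ⟨p, q, hpq⟩ := exists_common_diff_eq_norm T x y
  have h : (diff p q).comp T.toLinearEquiv.toLinearMap = diff x y :=
    linearMap_ext_of_diff_eq_norm hxy fun v hv => by rw [hv]; exact hpq v hv
  have h' : ∀ v, diff p q (T v) = diff x y v := fun v => LinearMap.congr_fun h v
  refine ⟨p, q, ?_, h'⟩
  rintro rfl
  obtain ⟨v, hv⟩ := exists_diff_eq_one hxy
  have := h' v
  rw [diff_self, hv] at this
  exact zero_ne_one this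

/-- Subtracting two rays from `x` extends the hypothesis to all pairs. Surjectivity of `s` comes
from `T.symm`. Each `f ∘ s⁻¹` is continuous, being a constant minus `diff a · (T (mk f))`, and such
`f` determine the topology. -/
theorem exists_homeomorph_of_diff_comp_eq (T : QuotConst K ≃ₗᵢ[ℝ] QuotConst K) {x a : K} {s : K → K}
    (hs : ∀ w, ∀ v, diff a (s w) (T v) = diff x w v) : ∃ θ : K ≃ₜ K, ∀ v, T v = act (1, θ) v := by
  have hss : ∀ w w' v, diff (s w) (s w') (T v) = diff w w' v := fun w w' v => by
    rw [← diff_sub_diff a, ← diff_sub_diff x w, hs, hs]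
  have hsx : s x = a := by
    by_contra hne
    obtain ⟨u, hu⟩ := exists_diff_eq_one (Ne.symm hne)
    have := hs x (T.symm u)
    rw [T.apply_symm_apply, hu, diff_self] at this
    exact one_ne_zero this
  have hinj : Function.Injective s := fun w w' hw => by
    by_contra hne
    obtain ⟨v, hv⟩ := exists_diff_eq_one hne
    have := hss w w' v
    rw [hw, diff_self, hv] at this
    exact zero_ne_one this
  have hsurj : Function.Surjective s := fun p => by
    by_cases hpa : p = a
    · exact ⟨x, hsx.trans hpa.symm⟩
    obtain ⟨w, w', -, hw⟩ := exists_diff_comp_eq T.symm hpa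
    refine ⟨w, (eq_of_diff_eq hpa (d := s w') fun u => ?_).1.symm⟩
    rw [← hw, ← hss, T.apply_symm_apply]
  let e : K ≃ K := Equiv.ofBijective s ⟨hinj, hsurj⟩
  have he : ∀ w, s (e.symm w) = w := fun w => e.apply_symm_apply w
  have hcont : ∀ f : C(K, ℝ), Continuous fun p => f (e.symm p) := fun f => by
    have heq : (fun p => f (e.symm p)) = fun p => f x - diff a p (T (mk f)) := by
      funext p
      have := hs (e.symm p) (mk f)
      rw [he, diff_mk] at this
      rw [this]; ring
    rw [heq]
    exact continuous_const.sub ((diff_continuous _).comp (Continuous.prodMk_right a))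
  have hsymm : Continuous e.symm := by
    rw [continuous_def]
    intro U hU
    rw [isOpen_iff_mem_nhds]
    intro q hq
    obtain ⟨f, h0, h1, -⟩ := exists_continuous_zero_one_of_isClosed
      (isClosed_singleton (x := e.symm q)) hU.isClosed_compl (by simpa using hq)
    have hmem : {p | f (e.symm p) < 1} ∈ nhds q :=
      (isOpen_lt (hcont f) continuous_const).mem_nhds (by
        have : f (e.symm q) = 0 := h0 rfl
        simp [this])
    filter_upwards [hmem] with p hp
    by_contra hpU
    exact (ne_of_lt hp) (h1 hpU)
  refine ⟨(hsymm.homeoOfEquivCompactToT2 (f := e.symm)).symm, fun v => ext_diff fun p q => ?_⟩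
  rw [diff_act]
  simp only [Units.val_one, Int.cast_one, one_mul, Homeomorph.symm_symm]
  change _ = diff (e.symm p) (e.symm q) v
  rw [← hss (e.symm p), he, he]

/-- The image pair of `(x, w)` either starts at `a` or ends at `b`, and likewise starts at `a` or
ends at `c`. As `b ≠ c`, it starts at `a`. -/
theorem exists_homeomorph_of_oriented (T : QuotConst K ≃ₗᵢ[ℝ] QuotConst K) {x y z a b c : K}
    (hxy : x ≠ y) (hxz : x ≠ z) (hyz : y ≠ z) (hb : ∀ v, diff a b (T v) = diff x y v)
    (hc : ∀ v, diff a c (T v) = diff x z v) : ∃ θ : K ≃ₜ K, ∀ v, T v = act (1, θ) v := by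
  have nondeg : ∀ {p q w : K}, x ≠ w → (∀ v, diff p q (T v) = diff x w v) → p ≠ q := by
    rintro p q w hw h rfl
    obtain ⟨v, hv⟩ := exists_diff_eq_one hw
    have := h v
    rw [diff_self, hv] at this
    exact zero_ne_one this
  have hbc : b ≠ c := by
    rintro rfl
    exact hyz (eq_of_diff_eq hxy fun v => (hb v).symm.trans (hc v)).2
  have aux : ∀ {w p q r y' : K}, x ≠ w → x ≠ y' → y' ≠ w → (∀ v, diff a r (T v) = diff x y' v) →
      (∀ v, diff p q (T v) = diff x w v) → a = p ∨ r = q := by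
    intro w p q r y' hw hxy' hyw hr hpq
    obtain ⟨p', q', hpq', h⟩ := exists_diff_comp_eq T hyw
    have := eq_or_eq_of_diff_add_diff (nondeg hxy' hr) hpq' (nondeg hw hpq) fun u => by
      have h1 := hr (T.symm u)
      have h2 := hpq (T.symm u)
      have h3 := h (T.symm u)
      rw [T.apply_symm_apply] at h1 h2 h3
      rw [h1, h2, h3, ← diff_sub_diff x y' w]
      ring
    tauto
  have star : ∀ w, ∃ q, ∀ v, diff a q (T v) = diff x w v := by
    intro w
    by_cases hwx : x = w
    · exact ⟨a, fun v => by rw [← hwx, diff_self, diff_self]⟩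
    by_cases hwy : y = w
    · exact ⟨b, hwy ▸ hb⟩
    by_cases hwz : z = w
    · exact ⟨c, hwz ▸ hc⟩
    obtain ⟨p, q, -, hpq⟩ := exists_diff_comp_eq T hwx
    have h1 := aux hwx hxy hwy hb hpq
    have h2 := aux hwx hxz hwz hc hpq
    have : a = p := by
      rcases h1 with h1 | h1
      · exact h1
      · exact h2.resolve_right fun h => hbc (h1.trans h.symm)
    exact ⟨q, this ▸ hpq⟩
  choose s hs using star
  exact exists_homeomorph_of_diff_comp_eq T hs

/-- Linear isometries of `C(K) / ℝ𝟏` are given by a sign and a homeomorphism. -/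
theorem exists_eq_act (T : QuotConst K ≃ₗᵢ[ℝ] QuotConst K) {x y z : K}
    (hxy : x ≠ y) (hxz : x ≠ z) (hyz : y ≠ z) : ∃ p : ℤˣ × (K ≃ₜ K), ∀ v, T v = act p v := by
  obtain ⟨a, b, hab, h1⟩ := exists_diff_comp_eq T hxy
  obtain ⟨c, d, hcd, h2⟩ := exists_diff_comp_eq T hyz
  obtain ⟨e, f, hef, h3⟩ := exists_diff_comp_eq T hxz
  -- Either the image pairs chain in the original order, or in the reverse order, in which case `-T`
  -- is oriented.
  rcases eq_or_eq_of_diff_add_diff hab hcd hef fun u => by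
    have h1 := h1 (T.symm u)
    have h2 := h2 (T.symm u)
    have h3 := h3 (T.symm u)
    rw [T.apply_symm_apply] at h1 h2 h3
    rw [h1, h2, h3, ← diff_sub_diff x y z]
    ring with ⟨-, rfl, -⟩ | ⟨-, -, rfl⟩
  · obtain ⟨θ, hθ⟩ := exists_homeomorph_of_oriented T hxy hxz hyz h1 h3
    exact ⟨(1, θ), hθ⟩
  · obtain ⟨θ, hθ⟩ := exists_homeomorph_of_oriented (T.trans (LinearIsometryEquiv.neg ℝ))
      (a := b) (b := a) (c := e) hxy hxz hyz
      (fun v => by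
        rw [← h1, diff_swap, LinearIsometryEquiv.trans_apply, LinearIsometryEquiv.coe_neg]; simp)
      (fun v => by
        rw [← h3, diff_swap, LinearIsometryEquiv.trans_apply, LinearIsometryEquiv.coe_neg]; simp)
    refine ⟨(-1, θ), fun v => ?_⟩
    have h : -T v = act (1, θ) v := hθ v
    rw [← neg_neg (T v), h]
    simp [act]

/-- Sign `-1` would give `p = θ⁻¹ q` whenever `p ≠ q`, so `θ⁻¹` would send both `y` and `z` to `x`.
-/
theorem eq_one_of_act_eq {x y z : K} (hxy : x ≠ y) (hxz : x ≠ z) (hyz : y ≠ z)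
    {p : ℤˣ × (K ≃ₜ K)} (h : ∀ v, act p v = v) : p = 1 := by
  obtain ⟨ε, θ⟩ := p
  have hd : ∀ p q v, diff p q v = ((ε : ℤ) : ℝ) * diff (θ.symm p) (θ.symm q) v := fun p q v => by
    conv_lhs => rw [← h v]
    exact diff_act _ _ _ _
  rcases Int.units_eq_one_or ε with rfl | rfl
  · have hfix : ∀ p, θ p = p := fun p => by
      obtain ⟨q, hq⟩ : ∃ q, p ≠ q := by
        by_cases hp : p = x
        · exact ⟨y, hp ▸ hxy⟩
        · exact ⟨x, hp⟩
      have := (eq_of_diff_eq hq fun v => by simpa using hd p q v).1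
      exact (congrArg θ this).trans (θ.apply_symm_apply p)
    exact Prod.ext rfl (Homeomorph.ext hfix)
  · have hsw : ∀ {p q}, p ≠ q → p = θ.symm q := fun {p q} hpq =>
      (eq_of_diff_eq hpq (d := θ.symm p) fun v => by
        rw [hd p q v, diff_swap (θ.symm p)]; simp).1
    exact absurd (θ.symm.injective ((hsw hxy).symm.trans (hsw hxz))) hyz

end Separation

/-! ### The isometry group and its centre -/

section Isometries

variable {K : Type*} [TopologicalSpace K] [CompactSpace K]

theorem norm_act_le (p : ℤˣ × (K ≃ₜ K)) (v : QuotConst K) : ‖act p v‖ ≤ ‖v‖ := by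
  rcases isEmpty_or_nonempty K with _ | _
  · obtain ⟨f, rfl⟩ := mk_surjective v
    obtain ⟨g, hg⟩ := mk_surjective (act p (mk f))
    rw [← hg]
    exact (variation_of_isEmpty g).trans_le (norm_nonneg _)
  · refine norm_le_of_diff_le fun x y => ?_
    rw [diff_act]
    obtain ⟨ε, θ⟩ := p
    rcases Int.units_eq_one_or ε with rfl | rfl
    · simpa using diff_le_norm _ _ v
    · simpa [← diff_swap] using diff_le_norm _ _ v

theorem norm_act (p : ℤˣ × (K ≃ₜ K)) (v : QuotConst K) : ‖act p v‖ = ‖v‖ := by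
  refine le_antisymm (norm_act_le p v) ?_
  have := norm_act_le p⁻¹ (act p v)
  rwa [← act_mul, inv_mul_cancel, act_one] at this

/-- The isometry `w ↦ v + p • w`. -/
noncomputable def affineIsometry (v : QuotConst K) (p : ℤˣ × (K ≃ₜ K)) :
    QuotConst K ≃ᵢ QuotConst K where
  toFun w := v + act p w
  invFun w := act p⁻¹ (w - v)
  left_inv w := by
    change act p⁻¹ (v + act p w - v) = w
    rw [add_sub_cancel_left, ← act_mul, inv_mul_cancel, act_one]
  right_inv w := by
    change v + act p (act p⁻¹ (w - v)) = w
    rw [← act_mul, mul_inv_cancel, act_one, add_sub_cancel]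
  isometry_toFun := Isometry.of_dist_eq fun w w' => by
    have h : act p (w - w') = act p w - act p w' := by
      rw [eq_sub_iff_add_eq, ← act_add, sub_add_cancel]
    rw [dist_add_left, dist_eq_norm, dist_eq_norm, ← h, norm_act]

/-- The homomorphism from the semidirect product to the isometry group. -/
noncomputable def toIsometryGroup :
    Multiplicative (QuotConst K) ⋊[action K] (ℤˣ × (K ≃ₜ K)) →*
      (QuotConst K ≃ᵢ QuotConst K) :=
  MonoidHom.mk' (fun g => affineIsometry g.left.toAdd g.right) fun g h => by
    refine IsometryEquiv.ext fun w => ?_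
    change (g.left * (action K g.right) h.left).toAdd + act (g.right * h.right) w =
      g.left.toAdd + act g.right (h.left.toAdd + act h.right w)
    rw [act_add, act_mul, toAdd_mul, add_assoc]
    rfl

/-- Commuting with negation fixes `0`; commuting with translations then fixes every point. -/
theorem eq_one_of_forall_commute (e : QuotConst K ≃ᵢ QuotConst K)
    (h : ∀ e' : QuotConst K ≃ᵢ QuotConst K, e * e' = e' * e) : e = 1 := by
  have h0 : e 0 = 0 := by
    have h1 : e (-0) = -e 0 := IsometryEquiv.ext_iff.1 (h (IsometryEquiv.neg _)) 0
    rw [neg_zero] at h1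
    have h2 : (2 : ℝ) • e 0 = 0 := by
      rw [two_smul]; nth_rewrite 1 [h1]; exact neg_add_cancel _
    exact (smul_eq_zero.1 h2).resolve_left two_ne_zero
  refine IsometryEquiv.ext fun v => ?_
  have h1 : e (v + 0) = v + e 0 := IsometryEquiv.ext_iff.1 (h (IsometryEquiv.addLeft v)) 0
  rwa [add_zero, h0, add_zero] at h1

variable [T2Space K]

theorem toIsometryGroup_bijective {x y z : K} (hxy : x ≠ y) (hxz : x ≠ z) (hyz : y ≠ z) :
    Function.Bijective (toIsometryGroup (K := K)) := by
  constructor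
  · rw [injective_iff_map_eq_one]
    intro g hg
    have hw : ∀ w, g.left.toAdd + act g.right w = w := fun w => IsometryEquiv.ext_iff.1 hg w
    have h0 : g.left.toAdd = 0 := by
      have hz : act g.right (0 : QuotConst K) = 0 := by simp [act]
      have := hw 0
      rwa [hz, add_zero] at this
    refine SemidirectProduct.ext (Multiplicative.toAdd.injective h0) ?_
    refine eq_one_of_act_eq hxy hxz hyz fun v => ?_
    have := hw v
    rwa [h0, zero_add] at this
  · intro e
    -- Mazur–Ulam: `w ↦ e w - e 0` is linear.
    obtain ⟨p, hp⟩ := exists_eq_act e.toRealLinearIsometryEquiv hxy hxz hyz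
    refine ⟨⟨Multiplicative.ofAdd (e 0), p⟩, IsometryEquiv.ext fun w => ?_⟩
    change e 0 + act p w = e w
    rw [← hp, IsometryEquiv.toRealLinearIsometryEquiv_apply, add_sub_cancel]

end Isometries

/-! ### At most two points -/

section FewPoints

theorem three_le_card_iff (α : Type*) :
    3 ≤ ENat.card α ↔ ∃ x y z : α, x ≠ y ∧ x ≠ z ∧ y ≠ z := by
  rw [← Set.encard_univ]
  constructor
  · intro h
    obtain ⟨t, -, ht⟩ := Set.exists_subset_encard_eq h
    obtain ⟨x, y, z, hxy, hxz, hyz, -⟩ := Set.encard_eq_three.1 ht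
    exact ⟨x, y, z, hxy, hxz, hyz⟩
  · rintro ⟨x, y, z, hxy, hxz, hyz⟩
    rw [← Set.encard_eq_three.2 ⟨x, y, z, hxy, hxz, hyz, rfl⟩]
    exact Set.encard_le_encard (Set.subset_univ _)

variable {K : Type*} [TopologicalSpace K] [T2Space K]

/-- On at most two points some homeomorphism acts as `-1` and is central. -/
theorem exists_central_act_trivial (h : ∀ x y z : K, x ≠ y → x ≠ z → y = z) :
    ∃ θ : K ≃ₜ K, (∀ v : QuotConst K, act (-1, θ) v = v) ∧ ∀ ψ : K ≃ₜ K, θ * ψ = ψ * θ := by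
  classical
  rcases subsingleton_or_nontrivial K with _ | ⟨x, y, hxy⟩
  · refine ⟨1, fun v => ext_diff fun p q => ?_, fun ψ => by simp⟩
    rw [Subsingleton.elim p q, diff_self, diff_self]
  · have hz : ∀ z, z = x ∨ z = y := fun z => by
      by_contra! hne
      exact hne.2 (h x y z hxy hne.1.symm).symm
    have : Finite K := Set.finite_univ_iff.1
      ((Set.toFinite {x, y}).subset fun z _ => by simpa using hz z)
    have : DiscreteTopology K := inferInstance
    let θ : K ≃ₜ K :=
      { Equiv.swap x y with
        continuous_toFun := continuous_of_discreteTopology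
        continuous_invFun := continuous_of_discreteTopology }
    have hx : θ x = y := Equiv.swap_apply_left x y
    have hy : θ y = x := Equiv.swap_apply_right x y
    have hx' : θ.symm x = y := by rw [← hy, θ.symm_apply_apply]
    have hy' : θ.symm y = x := by rw [← hx, θ.symm_apply_apply]
    have hne : ∀ z, z ≠ θ z := fun z => by
      rcases hz z with rfl | rfl
      · rw [hx]; exact hxy
      · rw [hy]; exact hxy.symm
    refine ⟨θ, fun v => ext_diff fun p q => ?_, fun ψ => Homeomorph.ext fun z => ?_⟩
    · rw [diff_act]
      rcases hz p with rfl | rfl <;> rcases hz q with rfl | rfl <;>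
        simp [hx', hy', diff_self, ← diff_swap]
    -- Both `θ (ψ z)` and `ψ (θ z)` differ from `ψ z`, leaving only one possible value.
    · exact h (ψ z) _ _ (hne _) (ψ.injective.ne (hne z))

end FewPoints

end VariationQuotient

open VariationQuotient in
theorem mainTheorem6 (K : Type*) [TopologicalSpace K] [CompactSpace K] [T2Space K] :
    Nonempty
        ((VariationQuotient.QuotConst K ≃ᵢ VariationQuotient.QuotConst K) ≃*
          (Multiplicative (VariationQuotient.QuotConst K) ⋊[VariationQuotient.action K]
            (ℤˣ × (K ≃ₜ K)))) ↔
      3 ≤ ENat.card K := by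
  rw [three_le_card_iff]
  constructor
  · rintro ⟨Φ⟩
    by_contra! hcard
    obtain ⟨θ, hact, hcomm⟩ := exists_central_act_trivial hcard
    -- Central because `(-1, θ)` acts trivially and is central in `C₂ × Homeo(K)`.
    let c : Multiplicative (QuotConst K) ⋊[action K] (ℤˣ × (K ≃ₜ K)) :=
      ⟨1, (-1, θ)⟩
    have hc : ∀ g, c * g = g * c := fun g => by
      refine SemidirectProduct.ext ?_ (Prod.ext (mul_comm _ _) (hcomm _))
      change 1 * Multiplicative.ofAdd (act (-1, θ) g.left.toAdd) = g.left * action K g.right 1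
      rw [hact, map_one, one_mul, mul_one]
      rfl
    have h1 : Φ.symm c = 1 := eq_one_of_forall_commute _ fun e' => by
      apply Φ.injective
      rw [map_mul, map_mul, Φ.apply_symm_apply, hc]
    have h2 : c = 1 := by simpa using h1
    have h3 : (-1 : ℤˣ) = 1 := congrArg (fun g => g.right.1) h2
    exact absurd h3 (by decide)
  · rintro ⟨x, y, z, hxy, hxz, hyz⟩
    exact ⟨(MulEquiv.ofBijective _ (toIsometryGroup_bijective hxy hxz hyz)).symm⟩
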